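/- Let $y_1<y_2$ be real numbers and let $X_1,X_2,\dots$ be independent random variables, each uniformly distributed on $(y_1,y_2)$. For $\tau>0$, $c\in(0,1)$ and $x\in(y_1,y_2)$ put $M_c=y_1+c(y_2-y_1)$ and $$N(x,\tau,c)=\begin{cases}\left(x-\tau(x-y_1),\;x+\frac{\tau(1-c)(x-y_1)}{c}\right)\cap(y_1,y_2) & \text{if } x\le M_c,\\[4pt] \left(x-\frac{c\,\tau(y_2-x)}{1-c},\;x+\tau(y_2-x)\right)\cap(y_1,y_2) & \text{if } x> M_c,\end{cases}$$ so that $N(x,1,1/2)$ is the open interval centred at $x$ of radius $\min(x-y_1,\,y_2-x)$ (the class cover catch digraph, CCCD, case). Let $D_n(\tau,c)$ be the digraph with vertices $X_1,\dots,X_n$ which, for $i\ne j$, has an arc from $X_i$ to $X_j$ if and only if $X_j\in N(X_i,\tau,c)$. Let $\rho_n(\tau,c)$ be its relative density, i.e. its number of arcs divided by $n(n-1)$ (and $0$ if $n\le 1$). Let $\mu(\tau,c)=P(X_2\in N(X_1,\tau,c))$ be the arc probability and $\nu(\tau,c)=\operatorname{Cov}(h_{12},h_{13})$, where $h_{ij}=\frac12\left(\mathbf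 1\{X_j\in N(X_i,\tau,c)\}+\mathbf 1\{X_i\in N(X_j,\tau,c)\}\right)$. Then $$\mu(1,1/2)=\tfrac12,\qquad 4\,\nu(1,1/2)=\tfrac1{12},$$ and, as $n\to\infty$, $$\sqrt n\,\bigl[\rho_n(1,1/2)-\mu(1,1/2)\bigr]\xrightarrow{\ \mathcal L\ }\mathcal N\bigl(0,\,4\,\nu(1,1/2)\bigr)=\mathcal N\bigl(0,\tfrac1{12}\bigr).$$ -/

import Mathlib

open MeasureTheory ProbabilityTheory Filter Topology

noncomputable section

/-- The central similarity proximity region of the point `x`, with expansion parameter `τ > 0` and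
centrality parameter `c ∈ (0,1)`, with respect to the two reference points `y₁ < y₂`.
The reference points themselves have the region `{x}`; a point of one of the two unbounded
end intervals `(-∞, y₁)`, `(y₂, ∞)` has a region with the expansion parameter only; a point of the
middle interval `(y₁, y₂)` has a region that depends on its side of
`M_c = y₁ + c (y₂ - y₁)`. At `x = M_c` both of the last two formulas give the same set. -/
def proximityRegion (y₁ y₂ τ c x : ℝ) : Set ℝ :=
  if x = y₁ ∨ x = y₂ then {x}
  else if x < y₁ then
    Set.Ioo (x - τ * (y₁ - x)) (x + τ * (y₁ - x)) ∩ Set.Iio y₁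
  else if y₂ < x then
    Set.Ioo (x - τ * (x - y₂)) (x + τ * (x - y₂)) ∩ Set.Ioi y₂
  else if x ≤ y₁ + c * (y₂ - y₁) then
    Set.Ioo (x - τ * (x - y₁)) (x + τ * (1 - c) * (x - y₁) / c) ∩ Set.Ioo y₁ y₂
  else
    Set.Ioo (x - c * τ * (y₂ - x) / (1 - c)) (x + τ * (y₂ - x)) ∩ Set.Ioo y₁ y₂

/-- The central similarity proximity catch digraph on the points `x 0, …, x (n - 1)`:
for `i ≠ j` there is an arc from `i` to `j` iff `x j` lies in the proximity region of `x i`. -/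
def proximityDigraph (y₁ y₂ τ c : ℝ) {n : ℕ} (x : Fin n → ℝ) : Digraph (Fin n) where
  Adj i j := i ≠ j ∧ x j ∈ proximityRegion y₁ y₂ τ c (x i)

/-- The relative density `|A| / (n (n - 1))` of a digraph on `n` vertices with arc set `A`;
it is `0` for `n ≤ 1`. -/
def relativeDensity {n : ℕ} (D : Digraph (Fin n)) : ℝ :=
  (Set.ncard {p : Fin n × Fin n | D.Adj p.1 p.2} : ℝ) / ((n : ℝ) * ((n : ℝ) - 1))

/-- The kernel `h`: half the number of arcs between two points at `x` and `x'`. -/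
def arcKernel (y₁ y₂ τ c x x' : ℝ) : ℝ :=
  ((proximityRegion y₁ y₂ τ c x).indicator 1 x' +
    (proximityRegion y₁ y₂ τ c x').indicator 1 x) / 2

section

variable {Ω : Type*} [MeasurableSpace Ω]

/-- The relative density `ρ_n(τ, c)` of the digraph on the first `n` of the random points
`X 0, X 1, …`. -/
def rho (y₁ y₂ τ c : ℝ) (X : ℕ → Ω → ℝ) (n : ℕ) (ω : Ω) : ℝ :=
  relativeDensity (proximityDigraph y₁ y₂ τ c fun i : Fin n => X i ω)

/-- The arc probability `μ(τ, c)`: the probability that the second point lies in the proximity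
region of the first. -/
def arcProbability (y₁ y₂ τ c : ℝ) (X : ℕ → Ω → ℝ) (P : Measure Ω) : ℝ :=
  P.real {ω | X 1 ω ∈ proximityRegion y₁ y₂ τ c (X 0 ω)}

/-- The covariance `ν(τ, c) = Cov(h₁₂, h₁₃)`. -/
def arcCovariance (y₁ y₂ τ c : ℝ) (X : ℕ → Ω → ℝ) (P : Measure Ω) : ℝ :=
  cov[fun ω => arcKernel y₁ y₂ τ c (X 0 ω) (X 1 ω),
    fun ω => arcKernel y₁ y₂ τ c (X 0 ω) (X 2 ω); P]

end

end

/-! For two points of `(y₁, y₂)` there is an arc from `x` to `y` iff `2 * x - y₂ < y < 2 * x - y₁`.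
So the relative density is almost surely the average of a bounded, non-symmetric kernel `k` over
ordered pairs of an i.i.d. sample. Hoeffding's projection applies. Let `f`, `g` be the means of `k`
over its second and first argument, and `θ` its total mean. The remainder `k x y - f x - g y + θ`
has zero mean in each variable, so its sum over the `n(n-1)` pairs has second moment `O(n²)`, and
`√n` times its average vanishes in probability (`tendstoInMeasure_degenerate`). What is left is a
normalised i.i.d. sum of `f + g`, to which the classical CLT and Slutsky's lemma apply
(`tendstoInDistribution_kernel_average`). For the uniform law, let `t` be `x` rescaled affinely to
`(-1, 1)`. Then `f = 1 - |t|` and `g = 1/2`, with `|t|` uniform on `(0, 1)`; hence the mean `1/2`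
and the variance `1/12` of `f + g`. -/

section Kernel

variable {Ω β : Type*} [MeasurableSpace Ω] [MeasurableSpace β] {P : Measure Ω}
  [IsProbabilityMeasure P] {ξ : ℕ → Ω → β} {μ : Measure β} [IsProbabilityMeasure μ]
  {k : β → β → ℝ} {C : ℝ}

/-! ### Kernels of an i.i.d. sample and Hoeffding's projection. -/

theorem integral_comp_prodMk_of_indepFun {γ δ : Type*} [MeasurableSpace γ] [MeasurableSpace δ]
    {W : Ω → γ} {V : Ω → δ} (hWV : IndepFun W V P) (hW : AEMeasurable W P)
    (hV : AEMeasurable V P) {F : γ → δ → ℝ} (hF : Measurable (Function.uncurry F))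
    (hb : ∀ w v, |F w v| ≤ C) :
    ∫ ω, F (W ω) (V ω) ∂P = ∫ w, ∫ v, F w v ∂(P.map V) ∂(P.map W) := by
  have := Measure.isProbabilityMeasure_map hW
  have := Measure.isProbabilityMeasure_map hV
  have hint : Integrable (Function.uncurry F) ((P.map W).prod (P.map V)) :=
    Integrable.of_bound hF.aestronglyMeasurable C (ae_of_all _ fun p => hb p.1 p.2)
  have h := integral_map (hW.prodMk hV) (f := Function.uncurry F) hF.aestronglyMeasurable
  rw [(indepFun_iff_map_prod_eq_prod_map_map hW hV).1 hWV, integral_prod _ hint] at h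
  exact h.symm

theorem measurable_integral_left (hk : Measurable (Function.uncurry k)) :
    Measurable fun x => ∫ y, k x y ∂μ :=
  (hk.stronglyMeasurable.integral_prod_right (ν := μ)).measurable

theorem measurable_integral_right (hk : Measurable (Function.uncurry k)) :
    Measurable fun y => ∫ x, k x y ∂μ :=
  measurable_integral_left (k := fun y x => k x y) (hk.comp measurable_swap)

theorem abs_integral_le_of_abs_le {f : β → ℝ} (hb : ∀ x, |f x| ≤ C) : |∫ x, f x ∂μ| ≤ C := by
  simpa using norm_integral_le_of_norm_le_const (μ := μ) (f := f) (ae_of_all _ hb)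

/-- Given `ξ 0`, the two variables are independent with the same conditional mean, so only the
variance of that conditional mean remains. -/
theorem covariance_kernel_eq_variance (hindep : iIndepFun ξ P) (hξ : ∀ i, AEMeasurable (ξ i) P)
    (hlaw : ∀ i, P.map (ξ i) = μ) (hk : Measurable (Function.uncurry k))
    (hb : ∀ x y, |k x y| ≤ C) :
    cov[fun ω => k (ξ 0 ω) (ξ 1 ω), fun ω => k (ξ 0 ω) (ξ 2 ω); P] =
      Var[fun x => ∫ y, k x y ∂μ; μ] := by
  have hC : 0 ≤ C := by
    have : Nonempty β := μ.nonempty_of_neZero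
    exact (abs_nonneg _).trans (hb Classical.ofNonempty Classical.ofNonempty)
  have hg := measurable_integral_left (μ := μ) hk
  have hgb : ∀ x, |∫ y, k x y ∂μ| ≤ C := fun x => abs_integral_le_of_abs_le (hb x)
  have hm : ∀ i j, AEMeasurable (fun ω => k (ξ i ω) (ξ j ω)) P := fun i j =>
    hk.comp_aemeasurable ((hξ i).prodMk (hξ j))
  have hL : ∀ i j, MemLp (fun ω => k (ξ i ω) (ξ j ω)) 2 P := fun i j =>
    MemLp.of_bound (hm i j).aestronglyMeasurable C (ae_of_all _ fun ω => hb _ _)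
  have hmean : ∀ j, (0 : ℕ) ≠ j → P[fun ω => k (ξ 0 ω) (ξ j ω)] = ∫ x, ∫ y, k x y ∂μ ∂μ := by
    intro j hj
    rw [integral_comp_prodMk_of_indepFun (hindep.indepFun hj) (hξ 0) (hξ j) hk hb, hlaw, hlaw]
  have h12 : IndepFun (fun ω => (ξ 0 ω, ξ 1 ω)) (ξ 2) P :=
    hindep.indepFun_prodMk₀ hξ 0 1 2 (by decide) (by decide)
  have hprod : P[(fun ω => k (ξ 0 ω) (ξ 1 ω)) * fun ω => k (ξ 0 ω) (ξ 2 ω)] =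
      ∫ x, (∫ y, k x y ∂μ) ^ 2 ∂μ := by
    have e1 := integral_comp_prodMk_of_indepFun h12 ((hξ 0).prodMk (hξ 1)) (hξ 2)
      (F := fun w v => k w.1 w.2 * k w.1 v) (C := C * C)
      (by
        have h1 : Measurable fun p : (β × β) × β => k p.1.1 p.1.2 := hk.comp measurable_fst
        have h2 : Measurable fun p : (β × β) × β => k p.1.1 p.2 :=
          hk.comp (by fun_prop : Measurable fun p : (β × β) × β => (p.1.1, p.2))
        exact h1.mul h2)
      (fun w v => by rw [abs_mul]; exact mul_le_mul (hb _ _) (hb _ _) (abs_nonneg _) hC)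
    have hG : Measurable (Function.uncurry fun x y => k x y * ∫ v, k x v ∂μ) :=
      hk.mul (hg.comp measurable_fst)
    have e2 := integral_comp_prodMk_of_indepFun (hindep.indepFun (zero_ne_one)) (hξ 0) (hξ 1)
      (F := fun x y => k x y * ∫ v, k x v ∂μ) (C := C * C) hG
      (fun w v => by rw [abs_mul]; exact mul_le_mul (hb _ _) (hgb _) (abs_nonneg _) hC)
    simp only [Pi.mul_apply]
    rw [e1, integral_map ((hξ 0).prodMk (hξ 1))]
    · simp only [hlaw, integral_const_mul] at e2 ⊢
      rw [e2]
      simp only [integral_mul_const, sq]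
    · simp only [hlaw, integral_const_mul]
      exact hG.aestronglyMeasurable
  rw [covariance_eq_sub (hL 0 1) (hL 0 2), hprod, hmean 1 (by decide), hmean 2 (by decide),
    variance_eq_sub (MemLp.of_bound hg.aestronglyMeasurable C (ae_of_all _ hgb))]
  simp only [Pi.pow_apply, sq]

/-- A kernel both of whose marginal means vanish gives uncorrelated variables at two pairs of
indices, one of which has a coordinate that occurs nowhere else. -/
theorem integral_mul_kernel_eq_zero (hindep : iIndepFun ξ P) (hξ : ∀ i, AEMeasurable (ξ i) P)
    (hlaw : ∀ i, P.map (ξ i) = μ) (hk : Measurable (Function.uncurry k))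
    (hb : ∀ x y, |k x y| ≤ C) (h0 : ∀ x, ∫ y, k x y ∂μ = 0) {κ : β → β → ℝ}
    (hκ : Measurable (Function.uncurry κ)) (hκb : ∀ x y, |κ x y| ≤ C) {i j l m : ℕ}
    (hij : i ≠ j) (hlj : l ≠ j) (hmj : m ≠ j) :
    ∫ ω, k (ξ i ω) (ξ j ω) * κ (ξ l ω) (ξ m ω) ∂P = 0 := by
  classical
  -- The indices `i`, `l`, `m` may coincide, so independence of `ξ j` from all three is taken from a
  -- finset.
  have hdisj : Disjoint ({i, l, m} : Finset ℕ) {j} := by simp [hij.symm, hlj.symm, hmj.symm]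
  have hI := hindep.indepFun_finset₀ _ _ hdisj hξ
  have hI' : IndepFun (fun ω => (ξ i ω, ξ l ω, ξ m ω)) (ξ j) P :=
    hI.comp
      (φ := fun w : ({i, l, m} : Finset ℕ) → β =>
        (w ⟨i, by simp⟩, w ⟨l, by simp⟩, w ⟨m, by simp⟩))
      (ψ := fun w : ({j} : Finset ℕ) → β => w ⟨j, by simp⟩) (by fun_prop) (by fun_prop)
  have hC : 0 ≤ C := by
    have : Nonempty β := μ.nonempty_of_neZero
    exact (abs_nonneg _).trans (hb Classical.ofNonempty Classical.ofNonempty)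
  have := integral_comp_prodMk_of_indepFun hI' ((hξ i).prodMk ((hξ l).prodMk (hξ m))) (hξ j)
    (F := fun w v => k w.1 v * κ w.2.1 w.2.2) (C := C * C)
    (by
      have h1 : Measurable fun p : (β × β × β) × β => k p.1.1 p.2 :=
        hk.comp (by fun_prop : Measurable fun p : (β × β × β) × β => (p.1.1, p.2))
      have h2 : Measurable fun p : (β × β × β) × β => κ p.1.2.1 p.1.2.2 :=
        hκ.comp (by fun_prop : Measurable fun p : (β × β × β) × β => p.1.2)
      exact h1.mul h2)
    (fun w v => by rw [abs_mul]; exact mul_le_mul (hb _ _) (hκb _ _) (abs_nonneg _) hC)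
  rw [this]
  simp [integral_mul_const, hlaw, h0]

theorem integral_sq_sum_offDiag_le (hindep : iIndepFun ξ P) (hξ : ∀ i, AEMeasurable (ξ i) P)
    (hlaw : ∀ i, P.map (ξ i) = μ) (hk : Measurable (Function.uncurry k))
    (hb : ∀ x y, |k x y| ≤ C) (h0 : ∀ x, ∫ y, k x y ∂μ = 0) (h0' : ∀ y, ∫ x, k x y ∂μ = 0)
    (n : ℕ) :
    ∫ ω, (∑ p ∈ (Finset.range n).offDiag, k (ξ p.1 ω) (ξ p.2 ω)) ^ 2 ∂P ≤
      2 * C ^ 2 * (n * (n - 1)) := by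
  have hC : 0 ≤ C := by
    have : Nonempty β := μ.nonempty_of_neZero
    exact (abs_nonneg _).trans (hb Classical.ofNonempty Classical.ofNonempty)
  have hm : ∀ i j, AEMeasurable (fun ω => k (ξ i ω) (ξ j ω)) P := fun i j =>
    hk.comp_aemeasurable ((hξ i).prodMk (hξ j))
  have hbd : ∀ (p q : ℕ × ℕ) ω,
      |k (ξ p.1 ω) (ξ p.2 ω) * k (ξ q.1 ω) (ξ q.2 ω)| ≤ C ^ 2 := fun p q ω => by
    rw [abs_mul, sq]; exact mul_le_mul (hb _ _) (hb _ _) (abs_nonneg _) hC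
  have hint : ∀ p q : ℕ × ℕ,
      Integrable (fun ω => k (ξ p.1 ω) (ξ p.2 ω) * k (ξ q.1 ω) (ξ q.2 ω)) P := fun p q =>
    Integrable.of_bound ((hm _ _).mul (hm _ _)).aestronglyMeasurable (C ^ 2)
      (ae_of_all _ (hbd p q))
  have key : ∀ p ∈ (Finset.range n).offDiag, ∀ q ∈ (Finset.range n).offDiag,
      ∫ ω, k (ξ p.1 ω) (ξ p.2 ω) * k (ξ q.1 ω) (ξ q.2 ω) ∂P ≤
        C ^ 2 * ((if p = q then 1 else 0) + if p.swap = q then 1 else 0) := by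
    rintro ⟨i, j⟩ hp ⟨l, m⟩ hq
    simp only [Finset.mem_offDiag] at hp hq
    have hle : ∫ ω, k (ξ i ω) (ξ j ω) * k (ξ l ω) (ξ m ω) ∂P ≤ C ^ 2 :=
      (le_abs_self _).trans (abs_integral_le_of_abs_le (hbd (i, j) (l, m)))
    -- Unless `q` is `p` or its swap, some coordinate of `p` is absent from `q`, and integrating
    -- over it kills the term. If the absent coordinate is the first one, the transposed kernel is
    -- used.
    have hzero : (l ≠ j ∧ m ≠ j) ∨ (l ≠ i ∧ m ≠ i) →
        ∫ ω, k (ξ i ω) (ξ j ω) * k (ξ l ω) (ξ m ω) ∂P = 0 := by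
      rintro (⟨h1, h2⟩ | ⟨h1, h2⟩)
      · exact integral_mul_kernel_eq_zero hindep hξ hlaw hk hb h0 hk hb hp.2.2 h1 h2
      · exact integral_mul_kernel_eq_zero (k := fun y x => k x y) hindep hξ hlaw
          (hk.comp measurable_swap) (fun x y => hb y x) h0' hk hb hp.2.2.symm h1 h2
    have hC2 := sq_nonneg C
    simp only [Prod.swap_prod_mk, Prod.mk.injEq]
    split_ifs with ha hb' hb'
    · linarith
    · linarith
    · linarith
    · rw [hzero (by grind)]; simp
  calc ∫ ω, (∑ p ∈ (Finset.range n).offDiag, k (ξ p.1 ω) (ξ p.2 ω)) ^ 2 ∂P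
      = ∑ p ∈ (Finset.range n).offDiag, ∑ q ∈ (Finset.range n).offDiag,
          ∫ ω, k (ξ p.1 ω) (ξ p.2 ω) * k (ξ q.1 ω) (ξ q.2 ω) ∂P := by
        simp only [sq, Finset.sum_mul_sum]
        rw [integral_finsetSum _ fun p _ => integrable_finsetSum _ fun q _ => hint p q]
        exact Finset.sum_congr rfl fun p _ => integral_finsetSum _ fun q _ => hint p q
    _ ≤ ∑ p ∈ (Finset.range n).offDiag, ∑ q ∈ (Finset.range n).offDiag,
          C ^ 2 * ((if p = q then 1 else 0) + if p.swap = q then 1 else 0) :=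
        Finset.sum_le_sum fun p hp => Finset.sum_le_sum fun q hq => key p hp q hq
    _ = ∑ p ∈ (Finset.range n).offDiag, 2 * C ^ 2 := by
        refine Finset.sum_congr rfl fun p hp => ?_
        have hs : p.swap ∈ (Finset.range n).offDiag := by
          simp only [Finset.mem_offDiag, Prod.fst_swap, Prod.snd_swap] at hp ⊢
          exact ⟨hp.2.1, hp.1, hp.2.2.symm⟩
        rw [← Finset.mul_sum, Finset.sum_add_distrib, Finset.sum_ite_eq, Finset.sum_ite_eq,
          if_pos hp, if_pos hs]
        ring
    _ = 2 * C ^ 2 * (n * (n - 1)) := by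
        rw [Finset.sum_const, Finset.offDiag_card, Finset.card_range, nsmul_eq_mul,
          Nat.cast_sub (Nat.le_mul_self n)]
        push_cast
        ring

theorem tendstoInMeasure_degenerate (hindep : iIndepFun ξ P) (hξ : ∀ i, AEMeasurable (ξ i) P)
    (hlaw : ∀ i, P.map (ξ i) = μ) (hk : Measurable (Function.uncurry k))
    (hb : ∀ x y, |k x y| ≤ C) (h0 : ∀ x, ∫ y, k x y ∂μ = 0) (h0' : ∀ y, ∫ x, k x y ∂μ = 0) :
    TendstoInMeasure P (fun (n : ℕ) ω => √(n : ℝ) *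
      ((∑ p ∈ (Finset.range n).offDiag, k (ξ p.1 ω) (ξ p.2 ω)) / (n * (n - 1)))) atTop 0 := by
  rw [tendstoInMeasure_iff_measureReal_norm]
  intro ε hε
  have hlim : Tendsto (fun n : ℕ => 2 * C ^ 2 / ε ^ 2 / ((n : ℝ) - 1)) atTop (𝓝 0) :=
    (tendsto_atTop_add_const_right _ (-1) tendsto_natCast_atTop_atTop).const_div_atTop _
  refine squeeze_zero' (.of_forall fun n => measureReal_nonneg) ?_ hlim
  filter_upwards [eventually_ge_atTop 2] with n hn
  have hn' : (2 : ℝ) ≤ n := by exact_mod_cast hn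
  have h1 : (0 : ℝ) < (n : ℝ) - 1 := by linarith
  set S : Ω → ℝ := fun ω => ∑ p ∈ (Finset.range n).offDiag, k (ξ p.1 ω) (ξ p.2 ω) with hS
  have hSm : AEMeasurable S P := Finset.aemeasurable_fun_sum _ fun p _ =>
    hk.comp_aemeasurable ((hξ p.1).prodMk (hξ p.2))
  have hSb : ∀ ω, |S ω| ≤ ∑ p ∈ (Finset.range n).offDiag, C := fun ω =>
    (Finset.abs_sum_le_sum_abs _ _).trans (Finset.sum_le_sum fun p _ => hb _ _)
  have hSi : Integrable (fun ω => S ω ^ 2) P :=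
    (MemLp.of_bound (p := 2) hSm.aestronglyMeasurable _ (ae_of_all _ hSb)).integrable_sq
  -- Chosen so that `a * S ω ^ 2` is the square of the scaled average; Markov's inequality then
  -- gives a bound of order `1 / (n - 1)`.
  set a : ℝ := n / (n * (n - 1)) ^ 2 with ha
  have hcheb := mul_meas_ge_le_integral_of_nonneg (μ := P) (f := fun ω => a * S ω ^ 2)
    (ae_of_all _ fun ω => by positivity) (hSi.const_mul a) (ε ^ 2)
  have hset : {ω | ε ≤ ‖√(n : ℝ) * (S ω / (n * (n - 1))) - (0 : Ω → ℝ) ω‖} ⊆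
      {ω | ε ^ 2 ≤ a * S ω ^ 2} := by
    intro ω hω
    simp only [Set.mem_ofPred_eq, Pi.zero_apply, sub_zero, Real.norm_eq_abs] at hω ⊢
    calc ε ^ 2 ≤ |√(n : ℝ) * (S ω / (n * (n - 1)))| ^ 2 := by gcongr
      _ = a * S ω ^ 2 := by
        rw [sq_abs, mul_pow, Real.sq_sqrt (by positivity), div_pow, ha]; ring
  have hmono := measureReal_mono (μ := P) hset
  rw [integral_const_mul] at hcheb
  have hint := integral_sq_sum_offDiag_le hindep hξ hlaw hk hb h0 h0' n
  calc _ ≤ P.real {ω | ε ^ 2 ≤ a * S ω ^ 2} := hmono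
    _ ≤ (a * ∫ ω, S ω ^ 2 ∂P) / ε ^ 2 := by
      rw [le_div_iff₀ (by positivity), mul_comm]; exact hcheb
    _ ≤ (a * (2 * C ^ 2 * (n * (n - 1)))) / ε ^ 2 := by gcongr
    _ = 2 * C ^ 2 / ε ^ 2 / ((n : ℝ) - 1) := by
      rw [ha]; field_simp

theorem sum_offDiag_range_fst (f : ℕ → ℝ) (n : ℕ) :
    ∑ p ∈ (Finset.range n).offDiag, f p.1 = (n - 1) * ∑ i ∈ Finset.range n, f i := by
  have h := Finset.sum_product (Finset.range n) (Finset.range n) fun p : ℕ × ℕ => f p.1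
  rw [← Finset.diag_union_offDiag, Finset.sum_union (Finset.disjoint_diag_offDiag _),
    Finset.sum_diag] at h
  simp only [Finset.sum_const, Finset.card_range, nsmul_eq_mul, ← Finset.mul_sum] at h
  linarith

theorem sum_offDiag_range_snd (f : ℕ → ℝ) (n : ℕ) :
    ∑ p ∈ (Finset.range n).offDiag, f p.2 = (n - 1) * ∑ i ∈ Finset.range n, f i := by
  have h := Finset.sum_product_right (Finset.range n) (Finset.range n) fun p : ℕ × ℕ => f p.2
  rw [← Finset.diag_union_offDiag, Finset.sum_union (Finset.disjoint_diag_offDiag _),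
    Finset.sum_diag] at h
  simp only [Finset.sum_const, Finset.card_range, nsmul_eq_mul, ← Finset.mul_sum] at h
  linarith

/-- **Hoeffding's central limit theorem** for the average of a bounded, not necessarily symmetric
kernel over the ordered pairs of distinct members of an i.i.d. sample. -/
theorem tendstoInDistribution_kernel_average (hindep : iIndepFun ξ P)
    (hξ : ∀ i, AEMeasurable (ξ i) P) (hlaw : ∀ i, P.map (ξ i) = μ)
    (hk : Measurable (Function.uncurry k)) (hb : ∀ x y, |k x y| ≤ C) :
    TendstoInDistribution (fun (n : ℕ) ω => √(n : ℝ) *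
        ((∑ p ∈ (Finset.range n).offDiag, k (ξ p.1 ω) (ξ p.2 ω)) / (n * (n - 1)) -
          ∫ x, ∫ y, k x y ∂μ ∂μ))
      atTop (id : ℝ → ℝ) (fun _ => P)
      (gaussianReal 0 Var[fun x => ∫ y, k x y ∂μ + ∫ y, k y x ∂μ; μ].toNNReal) := by
  set θ := ∫ x, ∫ y, k x y ∂μ ∂μ with hθ
  set f : β → ℝ := fun x => ∫ y, k x y ∂μ with hf
  set g : β → ℝ := fun y => ∫ x, k x y ∂μ with hg
  have hfm : Measurable f := measurable_integral_left hk
  have hgm : Measurable g := measurable_integral_right hk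
  have hfb : ∀ x, |f x| ≤ C := fun x => abs_integral_le_of_abs_le (hb x)
  have hgb : ∀ y, |g y| ≤ C := fun y => abs_integral_le_of_abs_le fun x => hb x y
  have hθb : |θ| ≤ C := abs_integral_le_of_abs_le hfb
  have hki : Integrable (Function.uncurry k) (μ.prod μ) :=
    Integrable.of_bound hk.aestronglyMeasurable C (ae_of_all _ fun p => hb p.1 p.2)
  have hfi : Integrable f μ := Integrable.of_bound hfm.aestronglyMeasurable C (ae_of_all _ hfb)
  have hgi : Integrable g μ := Integrable.of_bound hgm.aestronglyMeasurable C (ae_of_all _ hgb)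
  have hfθ : ∫ x, f x ∂μ = θ := rfl
  have hgθ : ∫ y, g y ∂μ = θ := (integral_integral_swap hki).symm
  have hkx : ∀ x, Integrable (fun y => k x y) μ := fun x =>
    Integrable.of_bound (hk.comp measurable_prodMk_left).aestronglyMeasurable C
      (ae_of_all _ (hb x))
  have hky : ∀ y, Integrable (fun x => k x y) μ := fun y =>
    Integrable.of_bound (hk.comp measurable_prodMk_right).aestronglyMeasurable C
      (ae_of_all _ fun x => hb x y)
  -- The doubly centred remainder of the Hoeffding decomposition.
  set φ : β → β → ℝ := fun x y => k x y - f x - g y + θ with hφ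
  have hφm : Measurable (Function.uncurry φ) :=
    ((hk.sub (hfm.comp measurable_fst)).sub (hgm.comp measurable_snd)).add_const θ
  have hφb : ∀ x y, |φ x y| ≤ 4 * C := fun x y => by
    have h1 := abs_le.1 (hb x y)
    have h2 := abs_le.1 (hfb x)
    have h3 := abs_le.1 (hgb y)
    have h4 := abs_le.1 hθb
    rw [abs_le]
    constructor <;> simp only [hφ] <;> linarith
  have hφ0 : ∀ x, ∫ y, φ x y ∂μ = 0 := fun x => by
    simp only [hφ]
    rw [integral_add (by fun_prop) (by fun_prop), integral_sub (by fun_prop) (by fun_prop),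
      integral_sub (by fun_prop) (by fun_prop), hgθ]
    simp [hf]
  have hφ0' : ∀ y, ∫ x, φ x y ∂μ = 0 := fun y => by
    simp only [hφ]
    rw [integral_add (by fun_prop) (by fun_prop), integral_sub (by fun_prop) (by fun_prop),
      integral_sub (by fun_prop) (by fun_prop), hfθ]
    simp [hg]
  set G : β → ℝ := fun x => f x + g x with hG
  have hGm : Measurable G := hfm.add hgm
  have hGb : ∀ x, |G x| ≤ C + C := fun x => (abs_add_le _ _).trans (add_le_add (hfb x) (hgb x))
  have hGint : ∫ ω, G (ξ 0 ω) ∂P = 2 * θ := by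
    rw [← integral_map (hξ 0) hGm.aestronglyMeasurable, hlaw, integral_add hfi hgi, hfθ, hgθ]
    ring
  have hGvar : Var[fun ω => G (ξ 0 ω); P] = Var[G; μ] := by
    rw [← hlaw 0, variance_map (by rw [hlaw]; exact hGm.aemeasurable) (hξ 0)]
    rfl
  have hclt := tendstoInDistribution_inv_sqrt_mul_sum_sub (P := P) (X := fun i ω => G (ξ i ω))
    (P' := gaussianReal 0 Var[G; μ].toNNReal) (Y := (id : ℝ → ℝ))
    (by rw [hGvar]; exact HasLaw.id)
    (MemLp.of_bound (hGm.comp_aemeasurable (hξ 0)).aestronglyMeasurable (C + C)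
      (ae_of_all _ fun ω => hGb _))
    (hindep.comp (fun _ => G) fun _ => hGm)
    (fun i => IdentDistrib.comp ⟨hξ i, hξ 0, by rw [hlaw, hlaw]⟩ hGm)
  refine tendstoInDistribution_of_tendstoInMeasure_sub _ _ hclt ?_ fun n => ?_
  · refine (tendstoInMeasure_degenerate hindep hξ hlaw hφm hφb hφ0 hφ0').congr' ?_ .rfl
    -- For `n ≤ 1` the division by `n * (n - 1)` is a division by zero, and the decomposition below
    -- fails.
    filter_upwards [eventually_ge_atTop 2] with n hn
    refine ae_of_all _ fun ω => ?_
    have hn' : (2 : ℝ) ≤ n := by exact_mod_cast hn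
    have h1 : ((n : ℝ) - 1) ≠ 0 := by linarith
    have h2 : (n : ℝ) ≠ 0 := by linarith
    have hs : √(n : ℝ) ≠ 0 := by positivity
    have hsum : ∑ p ∈ (Finset.range n).offDiag, φ (ξ p.1 ω) (ξ p.2 ω) =
        ∑ p ∈ (Finset.range n).offDiag, k (ξ p.1 ω) (ξ p.2 ω) -
          (n - 1) * ∑ i ∈ Finset.range n, G (ξ i ω) + n * (n - 1) * θ := by
      simp only [hφ, hG, Finset.sum_add_distrib, Finset.sum_sub_distrib, Finset.sum_const,
        Finset.offDiag_card, Finset.card_range, nsmul_eq_mul]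
      rw [sum_offDiag_range_fst (fun i => f (ξ i ω)), sum_offDiag_range_snd (fun i => g (ξ i ω)),
        Nat.cast_sub (Nat.le_mul_self n)]
      push_cast
      ring
    have hinv : (√(n : ℝ))⁻¹ = √(n : ℝ) / n := by
      rw [eq_div_iff h2, inv_mul_eq_iff_eq_mul₀ hs, Real.mul_self_sqrt (by positivity)]
    simp only [Pi.sub_apply, hsum, hGint, hinv]
    field_simp
    ring
  · have hS : AEMeasurable (fun ω => ∑ p ∈ (Finset.range n).offDiag, k (ξ p.1 ω) (ξ p.2 ω)) P :=
      Finset.aemeasurable_fun_sum _ fun p _ =>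
        hk.comp_aemeasurable ((hξ p.1).prodMk (hξ p.2))
    exact ((hS.div_const _).sub_const _).const_mul _

end Kernel

/-! ### The arc kernel under the uniform law. -/

section Uniform

variable {y₁ y₂ : ℝ}

/-- The indicator of the arcs of the class cover catch digraph between two points of
`(y₁, y₂)`. -/
noncomputable def arcIndicator (y₁ y₂ x y : ℝ) : ℝ :=
  (Set.Ioo (2 * x - y₂) (2 * x - y₁)).indicator 1 y

theorem arcIndicator_eq_ite (x y : ℝ) :
    arcIndicator y₁ y₂ x y = if 2 * x - y₂ < y ∧ y < 2 * x - y₁ then 1 else 0 := by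
  simp [arcIndicator, Set.indicator_apply]

theorem measurable_arcIndicator : Measurable (Function.uncurry (arcIndicator y₁ y₂)) := by
  have h1 : MeasurableSet {p : ℝ × ℝ | 2 * p.1 - y₂ < p.2} :=
    measurableSet_lt (by fun_prop) (by fun_prop)
  have h2 : MeasurableSet {p : ℝ × ℝ | p.2 < 2 * p.1 - y₁} :=
    measurableSet_lt (by fun_prop) (by fun_prop)
  have h : Function.uncurry (arcIndicator y₁ y₂) =
      ({p : ℝ × ℝ | 2 * p.1 - y₂ < p.2} ∩ {p : ℝ × ℝ | p.2 < 2 * p.1 - y₁}).indicator 1 := rfl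
  rw [h]
  exact measurable_one.indicator (h1.inter h2)

theorem abs_arcIndicator_le (x y : ℝ) : |arcIndicator y₁ y₂ x y| ≤ 1 := by
  rw [arcIndicator_eq_ite]
  split_ifs <;> simp

/-- On either side of the midpoint, one of the two inequalities already follows from `y` lying in
`(y₁, y₂)`; this removes the case split. -/
theorem mem_proximityRegion_iff {x y : ℝ} (hx : x ∈ Set.Ioo y₁ y₂) (hy : y ∈ Set.Ioo y₁ y₂) :
    y ∈ proximityRegion y₁ y₂ 1 (1 / 2) x ↔ 2 * x - y₂ < y ∧ y < 2 * x - y₁ := by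
  obtain ⟨hx1, hx2⟩ := hx
  obtain ⟨hy1, hy2⟩ := hy
  unfold proximityRegion
  rw [if_neg (by rintro (h | h) <;> linarith), if_neg hx1.not_gt, if_neg hx2.not_gt]
  split_ifs with h
  · simp only [Set.mem_inter_iff, Set.mem_Ioo]
    constructor
    · rintro ⟨⟨h1, h2⟩, -⟩
      constructor <;> linarith
    · rintro ⟨h1, h2⟩
      exact ⟨⟨by linarith, by linarith⟩, hy1, hy2⟩
  · have e : x - 1 / 2 * 1 * (y₂ - x) / (1 - 1 / 2) = 2 * x - y₂ := by ring
    simp only [Set.mem_inter_iff, Set.mem_Ioo, e]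
    constructor
    · rintro ⟨⟨h1, h2⟩, -⟩
      constructor <;> linarith
    · rintro ⟨h1, h2⟩
      exact ⟨⟨by linarith, by linarith⟩, hy1, hy2⟩

theorem indicator_proximityRegion {x y : ℝ} (hx : x ∈ Set.Ioo y₁ y₂) (hy : y ∈ Set.Ioo y₁ y₂) :
    (proximityRegion y₁ y₂ 1 (1 / 2) x).indicator 1 y = arcIndicator y₁ y₂ x y := by
  classical
  rw [arcIndicator_eq_ite, Set.indicator_apply]
  simp only [mem_proximityRegion_iff hx hy, Pi.one_apply]

theorem integral_cond_Ioo (hy : y₁ < y₂) (f : ℝ → ℝ) :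
    ∫ x, f x ∂(cond volume (Set.Ioo y₁ y₂)) = (y₂ - y₁)⁻¹ * ∫ x in y₁..y₂, f x := by
  rw [ProbabilityTheory.cond, integral_smul_measure, intervalIntegral.integral_of_le hy.le,
    integral_Ioc_eq_integral_Ioo, Real.volume_Ioo, ENNReal.toReal_inv,
    ENNReal.toReal_ofReal (by linarith), smul_eq_mul]

theorem cond_Ioo_real_Ioo (hy : y₁ < y₂) (a b : ℝ) :
    (cond volume (Set.Ioo y₁ y₂)).real (Set.Ioo a b) =
      (y₂ - y₁)⁻¹ * max (min y₂ b - max y₁ a) 0 := by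
  rw [Measure.real, cond_apply measurableSet_Ioo, Set.Ioo_inter_Ioo, Real.volume_Ioo,
    Real.volume_Ioo, ENNReal.toReal_mul, ENNReal.toReal_inv, ENNReal.toReal_ofReal (by linarith),
    ENNReal.toReal_ofReal']

theorem integral_arcIndicator_right (hy : y₁ < y₂) {x : ℝ} (hx : x ∈ Set.Ioo y₁ y₂) :
    ∫ y, arcIndicator y₁ y₂ x y ∂(cond volume (Set.Ioo y₁ y₂)) =
      1 - |2 / (y₂ - y₁) * x + -(y₁ + y₂) / (y₂ - y₁)| := by
  have hd : 0 < y₂ - y₁ := by linarith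
  have h1 : 2 / (y₂ - y₁) * x + -(y₁ + y₂) / (y₂ - y₁) = (2 * x - (y₁ + y₂)) / (y₂ - y₁) := by
    ring
  simp only [arcIndicator]
  rw [integral_indicator_one measurableSet_Ioo, cond_Ioo_real_Ioo hy, h1, abs_div, abs_of_pos hd]
  obtain ⟨hx1, hx2⟩ := hx
  field_simp
  rcases le_total 0 (2 * x - (y₁ + y₂)) with h | h
  · rw [abs_of_nonneg h, min_eq_left (by linarith), max_eq_right (a := y₁) (by linarith),
      max_eq_left (by linarith)]
    ring
  · rw [abs_of_nonpos h, min_eq_right (by linarith), max_eq_left (a := y₁) (by linarith),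
      max_eq_left (by linarith)]
    ring

/-- Solved for `x`, the arc condition describes a subinterval of `(y₁, y₂)` of half its length,
whatever `y` is. -/
theorem integral_arcIndicator_left (hy : y₁ < y₂) {y : ℝ} (hyI : y ∈ Set.Ioo y₁ y₂) :
    ∫ x, arcIndicator y₁ y₂ x y ∂(cond volume (Set.Ioo y₁ y₂)) = 1 / 2 := by
  have hd : 0 < y₂ - y₁ := by linarith
  have h : (fun x => arcIndicator y₁ y₂ x y) =
      (Set.Ioo ((y + y₁) / 2) ((y + y₂) / 2)).indicator 1 := by
    classical
    ext x
    rw [arcIndicator_eq_ite, Set.indicator_apply]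
    refine if_congr ?_ rfl rfl
    rw [Set.mem_Ioo]
    constructor <;> rintro ⟨h1, h2⟩ <;> constructor <;> linarith
  obtain ⟨h1, h2⟩ := hyI
  rw [h, integral_indicator_one measurableSet_Ioo, cond_Ioo_real_Ioo hy,
    min_eq_right (by linarith), max_eq_right (a := y₁) (by linarith), max_eq_left (by linarith)]
  field_simp
  ring

/-- The affine map carries `(y₁, y₂)` onto `(-1, 1)`, and the absolute value folds this into the
uniform law on `(0, 1)`. -/
theorem integral_abs_affine_cond_Ioo (hy : y₁ < y₂) {F : ℝ → ℝ} (hF : Continuous F) :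
    ∫ x, F |2 / (y₂ - y₁) * x + -(y₁ + y₂) / (y₂ - y₁)| ∂(cond volume (Set.Ioo y₁ y₂)) =
      ∫ t in (0 : ℝ)..1, F t := by
  have hd : y₂ - y₁ ≠ 0 := by linarith
  have e1 : 2 / (y₂ - y₁) * y₁ + -(y₁ + y₂) / (y₂ - y₁) = -1 := by field_simp; ring
  have e2 : 2 / (y₂ - y₁) * y₂ + -(y₁ + y₂) / (y₂ - y₁) = 1 := by field_simp; ring
  have hi : ∀ a b : ℝ, IntervalIntegrable (fun t => F |t|) volume a b := fun a b =>
    (hF.comp continuous_abs).intervalIntegrable a b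
  rw [integral_cond_Ioo hy, intervalIntegral.integral_comp_mul_add (fun t => F |t|) (by positivity),
    e1, e2, ← intervalIntegral.integral_add_adjacent_intervals (hi (-1) 0) (hi 0 1)]
  have hpos : ∫ t in (0 : ℝ)..1, F |t| = ∫ t in (0 : ℝ)..1, F t :=
    intervalIntegral.integral_congr fun t ht => by
      rw [Set.uIcc_of_le zero_le_one] at ht
      simp only [abs_of_nonneg ht.1]
  have hneg : ∫ t in (-1 : ℝ)..0, F |t| = ∫ t in (0 : ℝ)..1, F |t| := by
    have := intervalIntegral.integral_comp_neg (a := (0 : ℝ)) (b := 1) fun t => F |t|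
    simpa using this.symm
  rw [hneg, hpos, smul_eq_mul]
  field_simp
  ring

theorem integral_const_sub_pow_unitInterval (c : ℝ) (n : ℕ) :
    ∫ t in (0 : ℝ)..1, (c - t) ^ n = (c ^ (n + 1) - (c - 1) ^ (n + 1)) / (n + 1) := by
  rw [intervalIntegral.integral_comp_sub_left (fun t => t ^ n), integral_pow, sub_zero]

theorem isProbabilityMeasure_cond_Ioo (hy : y₁ < y₂) :
    IsProbabilityMeasure (cond (volume : Measure ℝ) (Set.Ioo y₁ y₂)) :=
  cond_isProbabilityMeasure_of_finite (by simp [hy]) (by simp)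

theorem integral_integral_arcIndicator (hy : y₁ < y₂) :
    ∫ x, ∫ y, arcIndicator y₁ y₂ x y ∂(cond volume (Set.Ioo y₁ y₂))
      ∂(cond volume (Set.Ioo y₁ y₂)) = 1 / 2 := by
  have hae : ∀ᵐ x ∂(cond volume (Set.Ioo y₁ y₂)), x ∈ Set.Ioo y₁ y₂ :=
    ae_cond_mem measurableSet_Ioo
  rw [integral_congr_ae (hae.mono fun x hx => integral_arcIndicator_right hy hx),
    integral_abs_affine_cond_Ioo hy (F := fun t => 1 - t) (by fun_prop)]
  have := integral_const_sub_pow_unitInterval 1 1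
  norm_num at this ⊢
  exact this

theorem variance_arcIndicator_projection (hy : y₁ < y₂) :
    Var[fun x => ∫ y, arcIndicator y₁ y₂ x y ∂(cond volume (Set.Ioo y₁ y₂)) +
        ∫ y, arcIndicator y₁ y₂ y x ∂(cond volume (Set.Ioo y₁ y₂));
      cond volume (Set.Ioo y₁ y₂)] = 1 / 12 := by
  have := isProbabilityMeasure_cond_Ioo hy
  have hae : ∀ᵐ x ∂(cond volume (Set.Ioo y₁ y₂)), x ∈ Set.Ioo y₁ y₂ :=
    ae_cond_mem measurableSet_Ioo
  have hc : (fun x => ∫ y, arcIndicator y₁ y₂ x y ∂(cond volume (Set.Ioo y₁ y₂)) +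
        ∫ y, arcIndicator y₁ y₂ y x ∂(cond volume (Set.Ioo y₁ y₂)))
      =ᵐ[cond volume (Set.Ioo y₁ y₂)]
      fun x => 3 / 2 - |2 / (y₂ - y₁) * x + -(y₁ + y₂) / (y₂ - y₁)| := by
    filter_upwards [hae] with x hx
    rw [integral_arcIndicator_right hy hx, integral_arcIndicator_left hy hx]
    ring
  have hm : Continuous fun x : ℝ =>
      3 / 2 - |2 / (y₂ - y₁) * x + -(y₁ + y₂) / (y₂ - y₁)| := by fun_prop
  have hmean := integral_abs_affine_cond_Ioo hy (F := fun t => 3 / 2 - t) (by fun_prop)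
  have hpow := integral_const_sub_pow_unitInterval (3 / 2) 1
  simp only [pow_one] at hpow
  rw [variance_congr hc, variance_eq_integral hm.aemeasurable, hmean, hpow,
    integral_abs_affine_cond_Ioo hy (F := fun t => (3 / 2 - t -
      ((3 / 2) ^ (1 + 1) - (3 / 2 - 1) ^ (1 + 1)) / ((1 : ℕ) + 1)) ^ 2) (by fun_prop)]
  -- The mean of `3 / 2 - t` is `1`, so the centred integrand is `(1 / 2 - t) ^ 2`.
  have := integral_const_sub_pow_unitInterval (1 / 2) 2
  rw [show (1 : ℝ) / 12 = ((1 / 2) ^ (2 + 1) - (1 / 2 - 1) ^ (2 + 1)) / ((2 : ℕ) + 1) by norm_num,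
    ← this]
  congr 1 with t
  norm_num
  ring

end Uniform

/-! ### From the digraph to the kernel average. -/

section Digraph

theorem relativeDensity_proximityDigraph {y₁ y₂ : ℝ} {x : ℕ → ℝ}
    (hx : ∀ i, x i ∈ Set.Ioo y₁ y₂) (n : ℕ) :
    relativeDensity (proximityDigraph y₁ y₂ 1 (1 / 2) fun i : Fin n => x i) =
      (∑ p ∈ (Finset.range n).offDiag, arcIndicator y₁ y₂ (x p.1) (x p.2)) / (n * (n - 1)) := by
  classical
  rw [relativeDensity]
  congr 1
  let S : Finset (ℕ × ℕ) := (Finset.range n).offDiag.filter fun p =>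
    2 * x p.1 - y₂ < x p.2 ∧ x p.2 < 2 * x p.1 - y₁
  have hS : ∑ p ∈ (Finset.range n).offDiag, arcIndicator y₁ y₂ (x p.1) (x p.2) = (S.card : ℝ) := by
    simp only [arcIndicator_eq_ite, Finset.sum_boole, S]
  rw [hS, ← Set.ncard_coe_finset S]
  congr 1
  refine Set.ncard_congr (fun p _ => ((p.1 : ℕ), (p.2 : ℕ))) ?_ ?_ ?_
  · rintro ⟨i, j⟩ ⟨hij, hm⟩
    simp only [mem_proximityRegion_iff (hx _) (hx _)] at hm
    simpa [S, Fin.val_inj] using ⟨hij, hm⟩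
  · rintro ⟨i, j⟩ ⟨k, l⟩ - - h
    simpa [Fin.ext_iff] using h
  · rintro ⟨i, j⟩ h
    simp only [S, Finset.coe_filter, Finset.mem_offDiag, Finset.mem_range,
      Set.mem_ofPred_eq] at h
    refine ⟨(⟨i, h.1.1⟩, ⟨j, h.1.2.1⟩), ⟨?_, ?_⟩, rfl⟩
    · simpa [Fin.ext_iff] using h.1.2.2
    · exact (mem_proximityRegion_iff (hx _) (hx _)).2 h.2

theorem mainTheorem7 {Ω : Type*} [MeasurableSpace Ω] (P : Measure Ω) [IsProbabilityMeasure P]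
    (y₁ y₂ : ℝ) (hy : y₁ < y₂) (X : ℕ → Ω → ℝ)
    (hindep : iIndepFun X P)
    (hunif : ∀ i, pdf.IsUniform (X i) (Set.Ioo y₁ y₂) P volume) :
    arcProbability y₁ y₂ 1 (1 / 2) X P = 1 / 2 ∧
    4 * arcCovariance y₁ y₂ 1 (1 / 2) X P = 1 / 12 ∧
    TendstoInDistribution
      (fun (n : ℕ) ω => √(n : ℝ) *
        (rho y₁ y₂ 1 (1 / 2) X n ω - arcProbability y₁ y₂ 1 (1 / 2) X P))
      atTop (id : ℝ → ℝ) (fun _ => P)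
      (gaussianReal 0 (4 * arcCovariance y₁ y₂ 1 (1 / 2) X P).toNNReal) := by
  set μ : Measure ℝ := cond volume (Set.Ioo y₁ y₂) with hμ
  have hprob : IsProbabilityMeasure μ := isProbabilityMeasure_cond_Ioo hy
  have hlaw : ∀ i, P.map (X i) = μ := hunif
  have hX : ∀ i, AEMeasurable (X i) P := fun i =>
    (hunif i).aemeasurable (by simp [hy]) (by simp)
  have hk := measurable_arcIndicator (y₁ := y₁) (y₂ := y₂)
  -- The sample lies in the interval only almost surely, so `proximityRegion` is replaced by the
  -- measurable `arcIndicator` up to null sets.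
  have hmem : ∀ᵐ ω ∂P, ∀ i, X i ω ∈ Set.Ioo y₁ y₂ := by
    refine ae_all_iff.2 fun i => ae_of_ae_map (hX i) ?_
    rw [hlaw]
    exact ae_cond_mem measurableSet_Ioo
  have hθ := integral_integral_arcIndicator hy
  have hvar := variance_arcIndicator_projection hy
  have hp : arcProbability y₁ y₂ 1 (1 / 2) X P = 1 / 2 := by
    have h := integral_comp_prodMk_of_indepFun (hindep.indepFun zero_ne_one) (hX 0) (hX 1) hk
      abs_arcIndicator_le
    rw [hlaw, hlaw, hθ] at h
    let A : Set Ω := {ω | 2 * X 0 ω - y₂ < X 1 ω ∧ X 1 ω < 2 * X 0 ω - y₁}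
    have hA : NullMeasurableSet A P :=
      (nullMeasurableSet_lt (((hX 0).const_mul 2).sub_const y₂) (hX 1)).inter
        (nullMeasurableSet_lt (hX 1) (((hX 0).const_mul 2).sub_const y₁))
    have hset : {ω | X 1 ω ∈ proximityRegion y₁ y₂ 1 (1 / 2) (X 0 ω)} =ᵐ[P] A := by
      filter_upwards [hmem] with ω hω
      exact propext (mem_proximityRegion_iff (hω 0) (hω 1))
    have hind : (fun ω => arcIndicator y₁ y₂ (X 0 ω) (X 1 ω)) = A.indicator fun _ => 1 := rfl
    rw [hind, integral_indicator₀ hA] at h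
    rw [arcProbability, measureReal_congr hset, ← h]
    simp
  have hc : 4 * arcCovariance y₁ y₂ 1 (1 / 2) X P = 1 / 12 := by
    let h : ℝ → ℝ → ℝ := fun x y => (arcIndicator y₁ y₂ x y + arcIndicator y₁ y₂ y x) / 2
    have hh : Measurable (Function.uncurry h) := (hk.add (hk.comp measurable_swap)).div_const 2
    have hhb : ∀ x y, |h x y| ≤ 1 := fun x y => by
      have h1 := abs_le.1 (abs_arcIndicator_le (y₁ := y₁) (y₂ := y₂) x y)
      have h2 := abs_le.1 (abs_arcIndicator_le (y₁ := y₁) (y₂ := y₂) y x)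
      rw [abs_le]
      constructor <;> simp only [h] <;> linarith
    have hae : ∀ j, (fun ω => arcKernel y₁ y₂ 1 (1 / 2) (X 0 ω) (X j ω)) =ᵐ[P]
        fun ω => h (X 0 ω) (X j ω) := fun j => by
      filter_upwards [hmem] with ω hω
      simp only [arcKernel, h, indicator_proximityRegion (hω 0) (hω j),
        indicator_proximityRegion (hω j) (hω 0)]
    have hcov : arcCovariance y₁ y₂ 1 (1 / 2) X P = Var[fun x => ∫ y, h x y ∂μ; μ] := by
      rw [← covariance_kernel_eq_variance hindep hX hlaw hh hhb, arcCovariance, covariance,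
        covariance, integral_congr_ae (hae 1), integral_congr_ae (hae 2)]
      refine integral_congr_ae ?_
      filter_upwards [hae 1, hae 2] with ω h1 h2
      rw [h1, h2]
    -- The symmetrised kernel projects to half of `f + g`; the resulting `1/4` in the variance
    -- cancels the factor `4`.
    have hproj : ∀ x, ∫ y, h x y ∂μ = 1 / 2 *
        (∫ y, arcIndicator y₁ y₂ x y ∂μ + ∫ y, arcIndicator y₁ y₂ y x ∂μ) := fun x => by
      simp only [h]
      rw [integral_div, integral_add]
      · ring
      · exact Integrable.of_bound (hk.comp measurable_prodMk_left).aestronglyMeasurable 1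
          (ae_of_all _ (abs_arcIndicator_le x))
      · exact Integrable.of_bound (hk.comp measurable_prodMk_right).aestronglyMeasurable 1
          (ae_of_all _ fun y => abs_arcIndicator_le y x)
    rw [hcov]
    simp only [hproj]
    rw [variance_const_mul, hvar]
    norm_num
  refine ⟨hp, hc, ?_⟩
  rw [hc, hp, ← hvar]
  refine (tendstoInDistribution_kernel_average hindep hX hlaw hk abs_arcIndicator_le).congr
    (fun n => ?_) .rfl
  filter_upwards [hmem] with ω hω
  rw [rho, relativeDensity_proximityDigraph hω, hθ]

end Digraph
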